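/- Let $n\ge 1$. The Kripke model $K_n=\bigcup_{d\ge 0}K_n^d$ is built as follows. Put $K_n^{-1}=\emptyset$. For $d\ge 0$, $K_n^d\setminus K_n^{d-1}$ consists of all formal points $w_{\beta,Y}$ such that $Y\subseteq K_n^{d-1}$ is decreasing, $Y\not\subseteq K_n^{d-2}$ if $d\ge 1$, $\beta\subseteq\{P_1,\dots,P_n\}$ is contained in $\mathrm{val}(v)$ for every $v\in Y$, and $\beta\ne\mathrm{val}(v)$ whenever $Y$ is the decreasing set generated by a single point $v$. Here $\mathrm{val}(w_{\beta,Y})=\beta$, and $v\le w_{\beta,Y}$ iff $v\in Y$ or $v=w_{\beta,Y}$. Let $\widehat{F}_n$ be the Heyting algebra of decreasing subsets of $(K_n,\le)$, with the metric $d(a,b)=2^{-\min\{i\,\mid\, a\cap K_n^i\ne b\cap K_n^i\}}$ (and $d(a,a)=0$). Let $[\![P_i]\!]=\{w\in K_n\mid P_i\in\mathrm{val}(w)\}$, and let the free Heyting algebra $F_n$ be identified with the Heyting subalgebra of $\widehat{F}_n$ generated by $[\![P_1]\!],\dots,[\![P_n]\!]$. Let $H$ be a Heyting subalgebra of $\widehat{F}_n$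 that is dense in the metric topology, and let $g_1,\dots,g_n$ be free generators of $F_n$ (either $g_i=[\![P_i]\!]$ for all $i$, or any family $g_1,\dots,g_n$ freely generating $F_n$ as a Heyting algebra) with $g_1,\dots,g_n\in H$. Then the set $\{g_1,\dots,g_n\}$ is $\emptyset$-definable in $H$, i.e. definable without parameters by a first-order formula in the language $\{0,1,\sqcap,\sqcup,\to\}$ of Heyting algebras. -/

import Mathlib

namespace Bellissima

open scoped FirstOrder

/-! ### The first-order language of Heyting algebras -/

/-- Function symbols `0, 1, ⊓, ⊔, →` of the language of Heyting algebras. -/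
inductive HeytingFunc : ℕ → Type
  | bot : HeytingFunc 0
  | top : HeytingFunc 0
  | inf : HeytingFunc 2
  | sup : HeytingFunc 2
  | himp : HeytingFunc 2

/-- The language of Heyting algebras, with no relation symbols besides equality. -/
def LHA : FirstOrder.Language.{0, 0} := ⟨HeytingFunc, fun _ => Empty⟩

/-- Every Heyting algebra is a structure for `LHA` in the obvious way. -/
instance heytingStructure (A : Type*) [HeytingAlgebra A] : LHA.Structure A where
  funMap := fun {k} (f : HeytingFunc k) =>
    match k, f with
    | _, .bot => fun _ => ⊥
    | _, .top => fun _ => ⊤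
    | _, .inf => fun x => x 0 ⊓ x 1
    | _, .sup => fun x => x 0 ⊔ x 1
    | _, .himp => fun x => x 0 ⇨ x 1
  RelMap := fun {_} r => Empty.elim r

/-- The family `g` freely generates the structure `F`: each map of the index set into a Heyting
algebra extends uniquely to a homomorphism. (Homomorphisms of `LHA`-structures are the maps that
preserve `0, 1, ⊓, ⊔, →`.) -/
def FreelyGenerates {ι F : Type} [LHA.Structure F] (g : ι → F) : Prop :=
  ∀ (A : Type) [HeytingAlgebra A] (f : ι → A), ∃! φ : F →[LHA] A, ∀ i, φ (g i) = f i

/-! ### The generic Kripke model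

The formal symbol `w_{β,Y}`, with `β` a valuation and `Y` a finite set of symbols constructed
before, is coded by a natural number through an injective coding of pairs `(β, Y)`. Valuations of
the variables `P_1, …, P_n` are finite subsets of `Fin n`. -/

/-- The symbol `w_{β,Y}`. -/
def sym {n : ℕ} (β : Finset (Fin n)) (Y : Finset ℕ) : ℕ := Encodable.encode (β, Y)

/-- The valuation of the symbol `w_{β,Y}`, which is `β`. -/
def symVal (n : ℕ) (w : ℕ) : Finset (Fin n) :=
  ((Encodable.decode w : Option (Finset (Fin n) × Finset ℕ)).getD (∅, ∅)).1

/-- The set `Y` of the points strictly below the symbol `w_{β,Y}`. -/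
def symBelow (n : ℕ) (w : ℕ) : Finset ℕ :=
  ((Encodable.decode w : Option (Finset (Fin n) × Finset ℕ)).getD (∅, ∅)).2

@[simp] theorem symVal_sym {n : ℕ} (β : Finset (Fin n)) (Y : Finset ℕ) :
    symVal n (sym β Y) = β := by
  simp [symVal, sym]

@[simp] theorem symBelow_sym {n : ℕ} (β : Finset (Fin n)) (Y : Finset ℕ) :
    symBelow n (sym β Y) = Y := by
  simp [symBelow, sym]

/-- The conditions on `w_{β,Y}` relative to a set `A` of points constructed before: `Y` is a
decreasing subset of `A`, `β` is contained in the valuation of each point of `Y`, and if `Y` is the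
decreasing set generated by a single point then `β` differs from the valuation of that point. -/
structure Admissible {n : ℕ} (A : Set ℕ) (β : Finset (Fin n)) (Y : Finset ℕ) : Prop where
  subset : ∀ v ∈ Y, v ∈ A
  decreasing : ∀ v ∈ Y, ∀ u ∈ symBelow n v, u ∈ Y
  val_subset : ∀ v ∈ Y, β ⊆ symVal n v
  ne_val : ∀ v ∈ Y, Y = insert v (symBelow n v) → β ≠ symVal n v

/-- `stage n 0` is the empty set `K_n^{-1}`, and `stage n (d + 1)` is `K_n^d`, the set of points of
foundation rank at most `d`. -/
def stage (n : ℕ) : ℕ → Set ℕ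
  | 0 => ∅
  | 1 => {w | ∃ (β : Finset (Fin n)) (Y : Finset ℕ), Admissible ∅ β Y ∧ w = sym β Y}
  | d + 2 => stage n (d + 1) ∪
      {w | ∃ (β : Finset (Fin n)) (Y : Finset ℕ), Admissible (stage n (d + 1)) β Y ∧
        ¬ (∀ v ∈ Y, v ∈ stage n d) ∧ w = sym β Y}

theorem stage_mono (n d : ℕ) : stage n d ⊆ stage n (d + 1) := by
  cases d with
  | zero => simp [stage]
  | succ d => exact Set.subset_union_left

theorem stage_admissible {n d w : ℕ} (h : w ∈ stage n (d + 1)) :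
    ∃ (β : Finset (Fin n)) (Y : Finset ℕ), Admissible (stage n d) β Y ∧ w = sym β Y := by
  induction d with
  | zero => simpa [stage] using h
  | succ d ih =>
    rcases h with h | ⟨β, Y, hA, -, rfl⟩
    · obtain ⟨β, Y, hA, rfl⟩ := ih h
      exact ⟨β, Y, ⟨fun v hv => stage_mono n d (hA.subset v hv), hA.decreasing, hA.val_subset,
        hA.ne_val⟩, rfl⟩
    · exact ⟨β, Y, hA, rfl⟩

/-- The points of the generic Kripke model: the union `K_n` of all the `K_n^d`. -/
@[ext] structure K (n : ℕ) where
  code : ℕ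
  mem : ∃ d, code ∈ stage n (d + 1)

/-- The valuation of a point of `K_n`. -/
def K.val {n : ℕ} (w : K n) : Finset (Fin n) := symVal n w.code

theorem mem_stage_of_below {n d v w : ℕ} (h : w ∈ stage n (d + 1)) (hv : v ∈ symBelow n w) :
    v ∈ stage n d := by
  obtain ⟨β, Y, hA, rfl⟩ := stage_admissible h
  exact hA.subset v (by simpa using hv)

theorem below_trans {n u v : ℕ} (w : K n) (hu : u ∈ symBelow n v) (hv : v ∈ symBelow n w.code) :
    u ∈ symBelow n w.code := by
  obtain ⟨d, h⟩ := w.mem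
  obtain ⟨β, Y, hA, hw⟩ := stage_admissible h
  rw [hw, symBelow_sym] at hv ⊢
  exact hA.decreasing v hv u hu

theorem below_asymm {n d : ℕ} : ∀ {v w : ℕ}, w ∈ stage n d → v ∈ symBelow n w →
    w ∈ symBelow n v → False := by
  induction d with
  | zero => intro v w h; simp [stage] at h
  | succ d ih => exact fun h hv hw => ih (mem_stage_of_below h hv) hw hv

/-- The order of `K_n`: `v ≤ w_{β,Y}` iff `v ∈ Y` or `v = w_{β,Y}`. -/
instance (n : ℕ) : PartialOrder (K n) where
  le v w := v.code ∈ symBelow n w.code ∨ v = w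
  le_refl _ := Or.inr rfl
  le_trans u v w huv hvw := by
    rcases huv with huv | rfl
    · rcases hvw with hvw | rfl
      · exact Or.inl (below_trans w huv hvw)
      · exact Or.inl huv
    · exact hvw
  le_antisymm v w hvw hwv := by
    rcases hvw with hvw | rfl
    · rcases hwv with hwv | rfl
      · obtain ⟨d, h⟩ := w.mem
        exact (below_asymm h hvw hwv).elim
      · rfl
    · rfl

theorem K.val_anti {n : ℕ} {v w : K n} (h : v ≤ w) : w.val ⊆ v.val := by
  rcases h with h | rfl
  · obtain ⟨d, hd⟩ := w.mem
    obtain ⟨β, Y, hA, hw⟩ := stage_admissible hd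
    rw [hw, symBelow_sym] at h
    have := hA.val_subset _ h
    rwa [K.val, K.val, hw, symVal_sym]
  · exact subset_rfl

/-! ### The completed free Heyting algebra, its metric, and the free Heyting algebra -/

/-- The Heyting algebra of the decreasing subsets of `K_n`, ordered by inclusion. -/
abbrev Fco (n : ℕ) : Type := LowerSet (K n)

/-- The element `⟦P_i⟧ = {w | P_i ∈ val w}`. -/
def gen {n : ℕ} (i : Fin n) : Fco n where
  carrier := {w | i ∈ w.val}
  lower' := fun _ _ h hw => K.val_anti h hw

/-- The free Heyting algebra on `n` generators, realized as the Heyting subalgebra of `Fco n`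
generated by `⟦P_1⟧, …, ⟦P_n⟧`. -/
def Fr (n : ℕ) : LHA.Substructure (Fco n) :=
  FirstOrder.Language.Substructure.closure LHA (Set.range (gen (n := n)))

/-- The truncation `a ∩ K_n^d`. -/
def trunc {n : ℕ} (d : ℕ) (a : Fco n) : Set (K n) := {w | w ∈ a ∧ w.code ∈ stage n (d + 1)}

theorem exists_trunc_ne {n : ℕ} {a b : Fco n} (h : a ≠ b) : ∃ d, trunc d a ≠ trunc d b := by
  by_contra hc
  push Not at hc
  refine h (SetLike.ext fun w => ?_)
  obtain ⟨d, hd⟩ := w.mem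
  have := Set.ext_iff.1 (hc d) w
  simpa [trunc, hd] using this

open Classical in
/-- The distance `2^{-min {d | a ∩ K_n^d ≠ b ∩ K_n^d}}`, which is `0` if there is no such `d`. -/
noncomputable def fdist {n : ℕ} (a b : Fco n) : ℝ :=
  if h : ∃ d, trunc d a ≠ trunc d b then (2 : ℝ)⁻¹ ^ Nat.find h else 0

theorem fdist_self {n : ℕ} (a : Fco n) : fdist a a = 0 := by
  simp [fdist]

theorem fdist_nonneg {n : ℕ} (a b : Fco n) : 0 ≤ fdist a b := by
  unfold fdist
  split_ifs <;> positivity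

theorem fdist_comm {n : ℕ} (a b : Fco n) : fdist a b = fdist b a := by
  have h : ∀ d, trunc d a ≠ trunc d b ↔ trunc d b ≠ trunc d a := fun _ => ne_comm
  by_cases hab : ∃ d, trunc d a ≠ trunc d b
  · have hba : ∃ d, trunc d b ≠ trunc d a := by simpa only [h] using hab
    rw [fdist, fdist, dif_pos hab, dif_pos hba]
    congr 1
    exact Nat.find_congr' (h _)
  · have hba : ¬ ∃ d, trunc d b ≠ trunc d a := by simpa only [h] using hab
    rw [fdist, fdist, dif_neg hab, dif_neg hba]

theorem eq_of_fdist_eq_zero {n : ℕ} {a b : Fco n} (h : fdist a b = 0) : a = b := by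
  by_contra hab
  rw [fdist, dif_pos (exists_trunc_ne hab)] at h
  exact absurd h (by positivity)

theorem fdist_ultra {n : ℕ} (a b c : Fco n) : fdist a c ≤ max (fdist a b) (fdist b c) := by
  classical
  by_cases h : ∃ d, trunc d a ≠ trunc d c
  · have key : ∀ {x y : Fco n}, trunc (Nat.find h) x ≠ trunc (Nat.find h) y →
        fdist a c ≤ fdist x y := by
      intro x y hxy
      have hxy' : ∃ d, trunc d x ≠ trunc d y := ⟨_, hxy⟩
      rw [fdist, dif_pos h, fdist, dif_pos hxy']
      exact pow_le_pow_of_le_one (by norm_num) (by norm_num) (Nat.find_min' hxy' hxy)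
    by_cases hab : trunc (Nat.find h) a = trunc (Nat.find h) b
    · exact le_max_of_le_right (key fun hbc => Nat.find_spec h (hab.trans hbc))
    · exact le_max_of_le_left (key hab)
  · rw [fdist, dif_neg h]
    exact le_max_of_le_left (fdist_nonneg a b)

/-- The metric on `Fco n`. -/
noncomputable instance (n : ℕ) : MetricSpace (Fco n) where
  dist := fdist
  dist_self := fdist_self
  dist_comm := fdist_comm
  dist_triangle a b c := (fdist_ultra a b c).trans
    (max_le_add_of_nonneg (fdist_nonneg a b) (fdist_nonneg b c))
  eq_of_dist_eq_zero := eq_of_fdist_eq_zero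

end Bellissima

/-!
The points of the Kripke model, its order and the valuation up to a permutation of the variables can
be read off from the lattice of any dense subalgebra, which makes the set of generators definable.

Ranks in the model have no gaps, so a finite lower set is isolated in the metric topology
(`eq_of_agree_on_stage`) and belongs to every dense set (`mem_of_dense_of_finite`). If a set `S` of
lower sets contains all the finite ones, then the elements of `S` having a greatest element strictly
below them are exactly the principal lower sets `Iic w` of the points `w`, with predecessor `Iio w`
(`IsFull.isPred_iff`). The points `u` with `Iio u = Z` correspond to the valuations admissible for
`Z`, and counting them gives information about the valuations in `Z`. The valuation of `v` has
exactly one element iff `Iio u = Iic v` for exactly one point `u`; and if `v` is the minimal point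
with valuation `{i}`, then `i ∈ val w` is expressed by the existence of one point `u`, or of two,
with `Iio u = Iic w ⊔ Iic v` (`K.mem_val_iff`). As `gen i` is determined by the points in it, one
first-order formula (`genFormula`), independent of `n`, defines the set of generators in every
subalgebra containing the finite lower sets.

The free generators are unique as a set. First, `Fr n` itself contains all finite lower sets
(`isFull_of_gen_mem`): the model has no nontrivial bisimulation, so the elements of `Fr n` separate
the points, by a Hennessy-Milner argument that uses the finiteness of `Iic w`. Secondly, a family
freely generating `Fr n` is mapped to the family `gen` by an endomorphism, which is surjective, and
injective because `Fr n` is Hopfian: it is finitely generated, and separated by the restrictions to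
the finite sets `stage n d`. This automorphism preserves the definable set of the elements `gen i`,
which therefore coincides with the given family of generators (`FreelyGenerates.exists_eq_iff`).
-/

namespace Bellissima

open FirstOrder

/-! ### Points of the Kripke model and the finite lower sets -/

variable {n : ℕ}

theorem stage_monotone (n : ℕ) : Monotone (stage n) := monotone_nat_of_le_succ (stage_mono n)

theorem stage_finite (n d : ℕ) : (stage n d).Finite := by
  induction d with
  | zero => exact Set.finite_empty
  | succ d ih =>
    have hfin : {Y : Finset ℕ | (Y : Set ℕ) ⊆ stage n d}.Finite :=
      ih.toFinset.powerset.finite_toSet.subset fun Y hY => by simpa using hY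
    refine ((Set.finite_univ (α := Finset (Fin n))).prod hfin |>.image
      fun p => sym p.1 p.2).subset fun w hw => ?_
    obtain ⟨β, Y, hA, rfl⟩ := stage_admissible hw
    exact ⟨(β, Y), ⟨trivial, hA.subset⟩, rfl⟩

theorem K.lt_iff {v w : K n} : v < w ↔ v.code ∈ symBelow n w.code := by
  refine ⟨fun h => h.le.resolve_right h.ne, fun h => lt_of_le_of_ne (Or.inl h) ?_⟩
  rintro rfl
  obtain ⟨d, hd⟩ := v.mem
  exact below_asymm hd h h

theorem K.exists_code_eq {w : K n} {c : ℕ} (h : c ∈ symBelow n w.code) :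
    ∃ v : K n, v.code = c := by
  obtain ⟨d, hd⟩ := w.mem
  have hc := mem_stage_of_below hd h
  cases d with
  | zero => exact hc.elim
  | succ d => exact ⟨⟨c, d, hc⟩, rfl⟩

theorem K.exists_admissible (w : K n) :
    ∃ d, Admissible (stage n d) w.val (symBelow n w.code) ∧
      w.code = sym w.val (symBelow n w.code) := by
  obtain ⟨d, hd⟩ := w.mem
  obtain ⟨β, Y, hA, hw⟩ := stage_admissible hd
  refine ⟨d, ?_⟩
  rw [K.val, hw, symVal_sym, symBelow_sym]
  exact ⟨hA, rfl⟩

theorem K.finite_stage (n d : ℕ) : {w : K n | w.code ∈ stage n d}.Finite :=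
  (stage_finite n d).preimage fun _ _ _ _ h => K.ext h

theorem K.finite_Iic (w : K n) : (Set.Iic w).Finite := by
  refine (((symBelow n w.code).finite_toSet.insert w.code).preimage
    (f := K.code) fun _ _ _ _ h => K.ext h).subset ?_
  rintro v (h | rfl)
  · exact Or.inr h
  · exact Or.inl rfl

/-- A point is determined by its valuation and the points strictly below it. -/
theorem K.eq_of_val_of_Iio {v w : K n} (hval : v.val = w.val)
    (h : LowerSet.Iio v = LowerSet.Iio w) : v = w := by
  obtain ⟨-, -, hv⟩ := v.exists_admissible
  obtain ⟨-, -, hw⟩ := w.exists_admissible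
  have key : ∀ u : K n, u < v ↔ u < w := fun u => by
    simpa using SetLike.ext_iff.1 h u
  refine K.ext ?_
  rw [hv, hw, hval]
  congr 1
  ext c
  constructor <;> intro hc <;> obtain ⟨u, rfl⟩ := K.exists_code_eq hc
  · exact K.lt_iff.1 ((key u).1 (K.lt_iff.2 hc))
  · exact K.lt_iff.1 ((key u).2 (K.lt_iff.2 hc))

theorem K.val_ne_of_Iio_eq_Iic {v w : K n} (h : LowerSet.Iio w = LowerSet.Iic v) :
    w.val ≠ v.val := by
  obtain ⟨d, hA, hw⟩ := w.exists_admissible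
  have key : ∀ u : K n, u < w ↔ u ≤ v := fun u => by
    simpa using SetLike.ext_iff.1 h u
  refine hA.ne_val v.code (K.lt_iff.1 ((key v).2 le_rfl)) ?_
  ext c
  rw [Finset.mem_insert]
  constructor
  · intro hc
    obtain ⟨u, rfl⟩ := K.exists_code_eq hc
    rcases (key u).1 (K.lt_iff.2 hc) with h | rfl
    · exact Or.inr h
    · exact Or.inl rfl
  · rintro (rfl | hc)
    · exact K.lt_iff.1 ((key v).2 le_rfl)
    · obtain ⟨u, rfl⟩ := K.exists_code_eq hc
      exact K.lt_iff.1 ((key u).2 (Or.inl hc))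

theorem exists_stage_of_finite {a : Fco n} (ha : (a : Set (K n)).Finite) :
    ∃ d, ∀ w ∈ a, w.code ∈ stage n d := by
  choose f hf using fun w : K n => w.mem
  obtain ⟨m, hm⟩ := (ha.image f).bddAbove
  exact ⟨m + 1, fun w hw => stage_monotone n (Nat.succ_le_succ (hm ⟨w, hw, rfl⟩)) (hf w)⟩

theorem mem_stage_succ_of_admissible {d : ℕ} {β : Finset (Fin n)} {Y : Finset ℕ}
    (h : Admissible (stage n d) β Y) : sym β Y ∈ stage n (d + 1) := by
  induction d with
  | zero => exact ⟨β, Y, h, rfl⟩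
  | succ d ih =>
    by_cases hY : ∀ v ∈ Y, v ∈ stage n d
    · exact Or.inl (ih ⟨hY, h.decreasing, h.val_subset, h.ne_val⟩)
    · exact Or.inr ⟨β, Y, h, hY, rfl⟩

/-- Every admissible pair of a valuation and a finite lower set is realized by a point. -/
theorem K.exists_of_admissible {Z : Fco n} (hZ : (Z : Set (K n)).Finite) {β : Finset (Fin n)}
    (hβ : ∀ z ∈ Z, β ⊆ z.val) (hne : ∀ z, Z = LowerSet.Iic z → β ≠ z.val) :
    ∃ w : K n, w.val = β ∧ LowerSet.Iio w = Z := by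
  classical
  obtain ⟨d, hd⟩ := exists_stage_of_finite hZ
  set Y : Finset ℕ := hZ.toFinset.image K.code with hYdef
  have hY : ∀ c, c ∈ Y ↔ ∃ z ∈ Z, z.code = c := fun c => by simp [hYdef]
  have hYK : ∀ z : K n, z.code ∈ Y ↔ z ∈ Z := fun z => by
    rw [hY]
    exact ⟨fun ⟨u, hu, h⟩ => K.ext h ▸ hu, fun h => ⟨z, h, rfl⟩⟩
  have hA : Admissible (stage n d) β Y := by
    constructor
    · intro v hv
      obtain ⟨z, hz, rfl⟩ := (hY v).1 hv
      exact hd z hz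
    · intro v hv u hu
      obtain ⟨z, hz, rfl⟩ := (hY v).1 hv
      obtain ⟨u, rfl⟩ := K.exists_code_eq hu
      exact (hYK u).2 (Z.lower (K.lt_iff.2 hu).le hz)
    · intro v hv
      obtain ⟨z, hz, rfl⟩ := (hY v).1 hv
      exact hβ z hz
    · intro v hv hYv
      obtain ⟨z, hz, rfl⟩ := (hY v).1 hv
      refine hne z (SetLike.ext fun u => ?_)
      rw [← hYK, hYv, Finset.mem_insert, LowerSet.mem_Iic_iff]
      exact ⟨fun h => h.elim (fun h => (K.ext h).le) Or.inl,
        fun h => h.elim Or.inr fun h => Or.inl (congrArg _ h)⟩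
  refine ⟨⟨sym β Y, d, mem_stage_succ_of_admissible hA⟩, symVal_sym β Y, SetLike.ext fun u => ?_⟩
  rw [LowerSet.mem_Iio_iff, K.lt_iff, ← hYK, symBelow_sym]

/-- Ranks have no gaps: below a point outside `stage n d` there is a point that first appears in the
next stage. -/
theorem K.exists_le_mem_stage_succ {e : ℕ} (w : K n) (hw : w.code ∉ stage n e) :
    ∃ v ≤ w, v.code ∈ stage n (e + 1) ∧ v.code ∉ stage n e := by
  obtain ⟨d, hd⟩ := w.mem
  induction d generalizing w with
  | zero => exact ⟨w, le_rfl, stage_monotone n (by omega) hd, hw⟩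
  | succ d ih =>
    rcases hd with hd | ⟨β, Y, hA, hY, hwY⟩
    · exact ih w hw hd
    · by_cases hde : d + 1 ≤ e
      · exact ⟨w, le_rfl, stage_monotone n (by omega : d + 2 ≤ e + 1)
          (Or.inr ⟨β, Y, hA, hY, hwY⟩), hw⟩
      · push Not at hY
        obtain ⟨c, hc, hcd⟩ := hY
        have hcw : c ∈ symBelow n w.code := by rwa [hwY, symBelow_sym]
        obtain ⟨v, rfl⟩ := K.exists_code_eq hcw
        obtain ⟨u, huv, hu⟩ := ih v (fun h => hcd (stage_monotone n (by omega) h)) (hA.subset _ hc)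
        exact ⟨u, huv.trans (K.lt_iff.2 hcw).le, hu⟩

/-- A lower set all of whose points have rank less than `d` is determined by its points of rank at
most `d`; in particular the finite lower sets are isolated in the metric topology. -/
theorem eq_of_agree_on_stage {a b : Fco n} {d : ℕ} (ha : ∀ w ∈ a, w.code ∈ stage n d)
    (h : ∀ w : K n, w.code ∈ stage n (d + 1) → (w ∈ a ↔ w ∈ b)) : a = b := by
  refine SetLike.ext fun w => ⟨fun hw => (h w (stage_mono n d (ha w hw))).1 hw, fun hw => ?_⟩
  by_cases hwd : w.code ∈ stage n d
  · exact (h w (stage_mono n d hwd)).2 hw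
  · obtain ⟨v, hvw, hv, hv'⟩ := w.exists_le_mem_stage_succ hwd
    exact (hv' (ha v ((h v hv).2 (b.lower hvw hw)))).elim

theorem trunc_eq_of_dist_lt {a b : Fco n} {d : ℕ} (h : dist a b < (2 : ℝ)⁻¹ ^ d) :
    trunc d a = trunc d b := by
  by_contra hne
  have hex : ∃ d, trunc d a ≠ trunc d b := ⟨d, hne⟩
  change fdist a b < _ at h
  rw [fdist, dif_pos hex] at h
  exact h.not_ge (pow_le_pow_of_le_one (by norm_num) (by norm_num) (Nat.find_min' hex hne))

/-- A dense set contains all finite lower sets. -/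
theorem mem_of_dense_of_finite {S : Set (Fco n)} (hS : Dense S) {a : Fco n}
    (ha : (a : Set (K n)).Finite) : a ∈ S := by
  obtain ⟨d, hd⟩ := exists_stage_of_finite ha
  obtain ⟨b, hb, hab⟩ := hS.exists_dist_lt a (show (0 : ℝ) < (2 : ℝ)⁻¹ ^ d by positivity)
  have ht := trunc_eq_of_dist_lt hab
  rwa [eq_of_agree_on_stage hd (b := b) fun w hw => ?_]
  have := Set.ext_iff.1 ht w
  simpa [trunc, hw] using this

/-! ### Recognizing points and generators among the elements of a set of lower sets -/

/-- A set of lower sets is full if it contains all the finite ones. -/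
def IsFull (S : Set (Fco n)) : Prop := ∀ a : Fco n, (a : Set (K n)).Finite → a ∈ S

/-- `b` is the greatest element of `S` strictly below `u`. -/
def IsPred (S : Set (Fco n)) (b u : Fco n) : Prop :=
  b ≤ u ∧ b ≠ u ∧ ∀ c ∈ S, c ≤ u → c ≠ u → c ≤ b

theorem K.self_mem_Iic (w : K n) : w ∈ LowerSet.Iic w := LowerSet.mem_Iic_iff.2 le_rfl

theorem K.Iio_lt_Iic (w : K n) : LowerSet.Iio w < LowerSet.Iic w :=
  lt_of_le_of_ne (fun _ h => LowerSet.mem_Iic_iff.2 (LowerSet.mem_Iio_iff.1 h).le)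
    fun h => lt_irrefl w (LowerSet.mem_Iio_iff.1 (h ▸ w.self_mem_Iic))

theorem finite_lowerSet_Iic (w : K n) : (LowerSet.Iic w : Set (K n)).Finite := w.finite_Iic

theorem finite_lowerSet_Iio (w : K n) : (LowerSet.Iio w : Set (K n)).Finite :=
  w.finite_Iic.subset fun _ h => (LowerSet.mem_Iio_iff.1 h).le

theorem _root_.LowerSet.le_Iio_of_le_Iic_of_ne {α : Type*} [PartialOrder α] {a : LowerSet α} {w : α}
    (h : a ≤ LowerSet.Iic w) (hne : a ≠ LowerSet.Iic w) : a ≤ LowerSet.Iio w := by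
  intro v hv
  refine lt_of_le_of_ne (LowerSet.mem_Iic_iff.1 (h hv)) ?_
  rintro rfl
  exact hne (h.antisymm (LowerSet.Iic_le.2 hv))

/-- In a full set, the elements having a greatest element strictly below them are exactly the
principal lower sets of the points. -/
theorem IsFull.isPred_iff {S : Set (Fco n)} (hS : IsFull S) {b u : Fco n} (hb : b ∈ S) :
    IsPred S b u ↔ ∃ w, u = LowerSet.Iic w ∧ b = LowerSet.Iio w := by
  constructor
  · rintro ⟨hbu, hne, hmax⟩
    obtain ⟨w, hwu, hwb⟩ : ∃ w ∈ u, w ∉ b := by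
      by_contra! h
      exact hne (hbu.antisymm h)
    have hu : u = LowerSet.Iic w := by
      by_contra h
      exact hwb (LowerSet.Iic_le.1
        (hmax _ (hS _ (finite_lowerSet_Iic w)) (LowerSet.Iic_le.2 hwu) (Ne.symm h)))
    subst hu
    refine ⟨w, rfl, le_antisymm (LowerSet.le_Iio_of_le_Iic_of_ne hbu hne) ?_⟩
    exact hmax _ (hS _ (finite_lowerSet_Iio w)) w.Iio_lt_Iic.le w.Iio_lt_Iic.ne
  · rintro ⟨w, rfl, rfl⟩
    exact ⟨w.Iio_lt_Iic.le, w.Iio_lt_Iic.ne, fun c _ => LowerSet.le_Iio_of_le_Iic_of_ne⟩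

theorem K.exists_Iio_eq_Iic_iff {w : K n} :
    (∃ u : K n, LowerSet.Iio u = LowerSet.Iic w) ↔ w.val.Nonempty := by
  constructor
  · rintro ⟨u, hu⟩
    have hwu : w < u := LowerSet.mem_Iio_iff.1 (hu ▸ K.self_mem_Iic _)
    rw [Finset.nonempty_iff_ne_empty]
    intro h
    exact K.val_ne_of_Iio_eq_Iic hu
      ((K.val_anti hwu.le).antisymm (h ▸ Finset.empty_subset _))
  · intro h
    obtain ⟨u, -, hu⟩ := K.exists_of_admissible (finite_lowerSet_Iic w) (β := ∅)
      (fun _ _ => Finset.empty_subset _)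
      (fun z hz hval => h.ne_empty (by rw [LowerSet.Iic_injective hz, ← hval]))
    exact ⟨u, hu⟩

/-- A point `v` has a one-element valuation iff the points `≤ v` are the points strictly below
exactly one point. -/
theorem K.exists_val_eq_singleton_iff {v : K n} :
    (∃ i, v.val = {i}) ↔ ∃! u : K n, LowerSet.Iio u = LowerSet.Iic v := by
  have hadm : ∀ β ⊂ v.val, ∃ u : K n, u.val = β ∧ LowerSet.Iio u = LowerSet.Iic v := by
    intro β hβ
    refine K.exists_of_admissible (finite_lowerSet_Iic v)
      (fun z hz => hβ.subset.trans (K.val_anti hz)) fun z hz h => hβ.ne ?_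
    rw [LowerSet.Iic_injective hz, h]
  have hsub : ∀ u : K n, LowerSet.Iio u = LowerSet.Iic v → u.val ⊂ v.val := fun u hu =>
    (K.val_anti (LowerSet.mem_Iio_iff.1 (hu ▸ K.self_mem_Iic _ :
      v ∈ LowerSet.Iio u)).le).ssubset_of_ne (K.val_ne_of_Iio_eq_Iic hu)
  constructor
  · rintro ⟨i, hi⟩
    obtain ⟨u, hu, hu'⟩ := hadm ∅ (hi ▸ (Finset.singleton_nonempty i).empty_ssubset)
    refine ⟨u, hu', fun t ht => K.eq_of_val_of_Iio ?_ (ht.trans hu'.symm)⟩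
    rw [hu, ← Finset.ssubset_singleton_iff, ← hi]
    exact hsub t ht
  · rintro ⟨u, hu, huniq⟩
    obtain ⟨i, hi⟩ := K.exists_Iio_eq_Iic_iff.1 ⟨u, hu⟩
    refine ⟨i, ?_⟩
    by_contra hne
    -- otherwise the valuations `∅` and `{i}` are both available above `v`
    obtain ⟨s, hs, hs'⟩ := hadm ∅ (Finset.empty_ssubset.2 ⟨i, hi⟩)
    obtain ⟨t, ht, ht'⟩ := hadm {i}
      ((Finset.singleton_subset_iff.2 hi).ssubset_of_ne (Ne.symm hne))
    have : s.val = t.val := by rw [huniq s hs', huniq t ht']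
    rw [hs, ht] at this
    exact Finset.singleton_ne_empty i this.symm

/-- If `v` is the minimal point with valuation `{i}`, then membership of `i` in the valuation of a
point is expressed through the order alone, by counting the points that lie immediately above
suitable lower sets. -/
theorem K.mem_val_iff {v w : K n} {i : Fin n} (hv : LowerSet.Iio v = ⊥) (hi : v.val = {i}) :
    i ∈ w.val ↔ (v ≤ w ∧ ∃ u : K n, LowerSet.Iio u = LowerSet.Iic w) ∨
      (¬ v ≤ w ∧ ∃ s t : K n, s ≠ t ∧ LowerSet.Iio s = LowerSet.Iic w ⊔ LowerSet.Iic v ∧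
        LowerSet.Iio t = LowerSet.Iic w ⊔ LowerSet.Iic v) := by
  by_cases hvw : v ≤ w
  · have hsub := K.val_anti hvw
    rw [hi, Finset.subset_singleton_iff] at hsub
    rw [K.exists_Iio_eq_Iic_iff]
    rcases hsub with h | h <;> simp [h, hvw]
  · simp only [hvw, false_and, not_false_eq_true, true_and, false_or]
    constructor
    · intro hiw
      have hfin : ((LowerSet.Iic w ⊔ LowerSet.Iic v : Fco n) : Set (K n)).Finite := by
        rw [LowerSet.coe_sup]
        exact (finite_lowerSet_Iic w).union (finite_lowerSet_Iic v)
      have hnp : ∀ z, LowerSet.Iic w ⊔ LowerSet.Iic v ≠ LowerSet.Iic z := by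
        intro z hz
        have hwz : w ≤ z :=
          LowerSet.mem_Iic_iff.1 (hz ▸ LowerSet.mem_sup_iff.2 (Or.inl w.self_mem_Iic))
        have hvz : v ≤ z :=
          LowerSet.mem_Iic_iff.1 (hz ▸ LowerSet.mem_sup_iff.2 (Or.inr (K.self_mem_Iic _)))
        have hzz : z ∈ LowerSet.Iic w ⊔ LowerSet.Iic v := hz ▸ K.self_mem_Iic _
        rcases LowerSet.mem_sup_iff.1 hzz with h | h
        · exact hvw (hvz.trans h)
        · have hwv : w ≤ v := hwz.trans h
          rcases hwv.lt_or_eq with h | h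
          · have : w ∈ LowerSet.Iio v := h
            rw [hv] at this
            exact this
          · exact hvw h.ge
      have hadm : ∀ β ⊆ {i}, ∃ u : K n, u.val = β ∧
          LowerSet.Iio u = LowerSet.Iic w ⊔ LowerSet.Iic v := by
        intro β hβ
        refine K.exists_of_admissible hfin (fun z hz => hβ.trans ?_) fun z hz => (hnp z hz).elim
        rcases LowerSet.mem_sup_iff.1 hz with h | h
        · exact Finset.singleton_subset_iff.2 (K.val_anti h hiw)
        · exact hi ▸ K.val_anti h
      obtain ⟨s, hs, hs'⟩ := hadm ∅ (Finset.empty_subset _)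
      obtain ⟨t, ht, ht'⟩ := hadm {i} subset_rfl
      refine ⟨s, t, ?_, hs', ht'⟩
      rintro rfl
      rw [hs] at ht
      exact Finset.singleton_ne_empty i ht.symm
    · rintro ⟨s, t, hst, hs, ht⟩
      have hsub : ∀ u : K n, LowerSet.Iio u = LowerSet.Iic w ⊔ LowerSet.Iic v →
          u.val ⊆ w.val ∧ u.val ⊆ {i} := by
        intro u hu
        have hwu : w ∈ LowerSet.Iio u := hu ▸ LowerSet.mem_sup_iff.2 (Or.inl (K.self_mem_Iic _))
        have hvu : v ∈ LowerSet.Iio u := hu ▸ LowerSet.mem_sup_iff.2 (Or.inr (K.self_mem_Iic _))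
        exact ⟨K.val_anti (le_of_lt hwu), hi ▸ K.val_anti (le_of_lt hvu)⟩
      have hval : s.val ≠ t.val := fun h => hst (K.eq_of_val_of_Iio h (hs.trans ht.symm))
      by_contra hiw
      have hempty : ∀ u : K n, LowerSet.Iio u = LowerSet.Iic w ⊔ LowerSet.Iic v →
          u.val = ∅ := by
        intro u hu
        refine (Finset.subset_singleton_iff.1 (hsub u hu).2).resolve_right fun h => hiw ?_
        exact (hsub u hu).1 (h ▸ Finset.mem_singleton_self i)
      exact hval ((hempty s hs).trans (hempty t ht).symm)

/-- There is a minimal point with valuation `{i}`. -/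
theorem K.exists_minimal (i : Fin n) : ∃ v : K n, v.val = {i} ∧ LowerSet.Iio v = ⊥ :=
  K.exists_of_admissible (by simp) (fun _ hz => hz.elim)
    fun z hz => (hz ▸ z.self_mem_Iic : z ∈ (⊥ : Fco n)).elim

/-- A property of `x` that speaks only of the elements of `S` and the lattice operations. If `S` is
full, then it says that some `v ∈ S` is the principal lower set of a minimal point with a one-element
valuation `{i}`, and that `x` contains exactly the points with `i` in their valuation. -/
def IsGenIn (S : Set (Fco n)) (x : Fco n) : Prop :=
  ∃ v ∈ S, IsPred S ⊥ v ∧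
    (∃ u ∈ S, IsPred S v u ∧ ∀ u' ∈ S, IsPred S v u' → u' = u) ∧
    ∀ w ∈ S, (∃ b ∈ S, IsPred S b w) →
      (w ≤ x ↔ (v ≤ w ∧ ∃ u ∈ S, IsPred S w u) ∨
        (¬ v ≤ w ∧ ∃ s ∈ S, ∃ t ∈ S, s ≠ t ∧ IsPred S (w ⊔ v) s ∧ IsPred S (w ⊔ v) t))

theorem IsFull.exists_isPred_iff {S : Set (Fco n)} (hS : IsFull S) {b : Fco n} (hb : b ∈ S) :
    (∃ u ∈ S, IsPred S b u) ↔ ∃ u : K n, LowerSet.Iio u = b := by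
  constructor
  · rintro ⟨_, -, h⟩
    obtain ⟨u, -, hu⟩ := (hS.isPred_iff hb).1 h
    exact ⟨u, hu.symm⟩
  · rintro ⟨u, rfl⟩
    exact ⟨_, hS _ (finite_lowerSet_Iic u), (hS.isPred_iff hb).2 ⟨u, rfl, rfl⟩⟩

/-- The right-hand side in the definition of `IsGenIn` expresses membership in the valuation. -/
theorem IsFull.mem_val_iff {S : Set (Fco n)} (hS : IsFull S) {v w : K n} {i : Fin n}
    (hv : LowerSet.Iio v = ⊥) (hi : v.val = {i}) :
    i ∈ w.val ↔ (LowerSet.Iic v ≤ LowerSet.Iic w ∧ ∃ u ∈ S, IsPred S (LowerSet.Iic w) u) ∨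
      (¬ LowerSet.Iic v ≤ LowerSet.Iic w ∧ ∃ s ∈ S, ∃ t ∈ S, s ≠ t ∧
        IsPred S (LowerSet.Iic w ⊔ LowerSet.Iic v) s ∧
        IsPred S (LowerSet.Iic w ⊔ LowerSet.Iic v) t) := by
  have hsup : LowerSet.Iic w ⊔ LowerSet.Iic v ∈ S := hS _ (by
    rw [LowerSet.coe_sup]
    exact (finite_lowerSet_Iic w).union (finite_lowerSet_Iic v))
  rw [K.mem_val_iff hv hi, hS.exists_isPred_iff (hS _ (finite_lowerSet_Iic w)), LowerSet.Iic_le,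
    LowerSet.mem_Iic_iff]
  refine or_congr_right (and_congr_right fun _ => ?_)
  constructor
  · rintro ⟨s, t, hst, hs, ht⟩
    exact ⟨_, hS _ (finite_lowerSet_Iic s), _, hS _ (finite_lowerSet_Iic t),
      fun h => hst (LowerSet.Iic_injective h),
      (hS.isPred_iff hsup).2 ⟨s, rfl, hs.symm⟩, (hS.isPred_iff hsup).2 ⟨t, rfl, ht.symm⟩⟩
  · rintro ⟨_, -, _, -, hne, hs, ht⟩
    obtain ⟨s, rfl, hs'⟩ := (hS.isPred_iff hsup).1 hs
    obtain ⟨t, rfl, ht'⟩ := (hS.isPred_iff hsup).1 ht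
    exact ⟨s, t, fun h => hne (h ▸ rfl), hs'.symm, ht'.symm⟩

theorem IsFull.isGenIn_iff {S : Set (Fco n)} (hS : IsFull S) {x : Fco n} :
    IsGenIn S x ↔ ∃ i, x = gen i := by
  have hbot : ⊥ ∈ S := hS _ (by simp)
  have hIic := fun w : K n => hS _ (finite_lowerSet_Iic w)
  have hexu : ∀ v : K n, (∃ u ∈ S, IsPred S (LowerSet.Iic v) u ∧
      ∀ u' ∈ S, IsPred S (LowerSet.Iic v) u' → u' = u) ↔
      ∃! u : K n, LowerSet.Iio u = LowerSet.Iic v := by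
    intro v
    constructor
    · rintro ⟨_, -, hu, huniq⟩
      obtain ⟨u, rfl, hu'⟩ := (hS.isPred_iff (hIic v)).1 hu
      exact ⟨u, hu'.symm, fun t ht => LowerSet.Iic_injective (huniq _ (hIic t)
        ((hS.isPred_iff (hIic v)).2 ⟨t, rfl, ht.symm⟩))⟩
    · rintro ⟨u, hu, huniq⟩
      refine ⟨_, hIic u, (hS.isPred_iff (hIic v)).2 ⟨u, rfl, hu.symm⟩, fun t _ ht => ?_⟩
      obtain ⟨t, rfl, ht'⟩ := (hS.isPred_iff (hIic v)).1 ht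
      rw [huniq t ht'.symm]
  constructor
  · rintro ⟨_, -, hv, hone, hx⟩
    obtain ⟨v, rfl, hv'⟩ := (hS.isPred_iff hbot).1 hv
    obtain ⟨i, hi⟩ := (K.exists_val_eq_singleton_iff).2 ((hexu v).1 hone)
    refine ⟨i, SetLike.ext fun w => ?_⟩
    have := hx (LowerSet.Iic w) (hIic w) ⟨_, hS _ (finite_lowerSet_Iio w),
      (hS.isPred_iff (hS _ (finite_lowerSet_Iio w))).2 ⟨w, rfl, rfl⟩⟩
    rw [← hS.mem_val_iff hv'.symm hi, LowerSet.Iic_le] at this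
    exact this
  · rintro ⟨i, rfl⟩
    obtain ⟨v, hi, hv⟩ := K.exists_minimal i
    refine ⟨_, hIic v, (hS.isPred_iff hbot).2 ⟨v, rfl, hv.symm⟩,
      (hexu v).2 ((K.exists_val_eq_singleton_iff).1 ⟨i, hi⟩), ?_⟩
    rintro _ - ⟨b, hb, hw⟩
    obtain ⟨w, rfl, -⟩ := (hS.isPred_iff hb).1 hw
    rw [← hS.mem_val_iff hv hi, LowerSet.Iic_le]
    exact Iff.rfl

/-! ### Heyting subalgebras -/

section Substructure

variable (S : LHA.Substructure (Fco n)) {a b : Fco n}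

theorem bot_mem_substructure : ⊥ ∈ S :=
  S.fun_mem (HeytingFunc.bot : LHA.Functions 0) ![] (fun i => i.elim0)

theorem top_mem_substructure : ⊤ ∈ S :=
  S.fun_mem (HeytingFunc.top : LHA.Functions 0) ![] (fun i => i.elim0)

variable {S}

theorem inf_mem_substructure (ha : a ∈ S) (hb : b ∈ S) : a ⊓ b ∈ S :=
  S.fun_mem (HeytingFunc.inf : LHA.Functions 2) ![a, b] (Fin.forall_fin_two.2 ⟨ha, hb⟩)

theorem sup_mem_substructure (ha : a ∈ S) (hb : b ∈ S) : a ⊔ b ∈ S :=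
  S.fun_mem (HeytingFunc.sup : LHA.Functions 2) ![a, b] (Fin.forall_fin_two.2 ⟨ha, hb⟩)

theorem himp_mem_substructure (ha : a ∈ S) (hb : b ∈ S) : a ⇨ b ∈ S :=
  S.fun_mem (HeytingFunc.himp : LHA.Functions 2) ![a, b] (Fin.forall_fin_two.2 ⟨ha, hb⟩)

theorem exists_mem_iff_exists {ι : Type*} {s : Set ι} (hs : s.Finite) (r : ι → Fco n)
    (hr : ∀ i ∈ s, r i ∈ S) : ∃ b ∈ S, ∀ w, w ∈ b ↔ ∃ i ∈ s, w ∈ r i := by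
  induction s, hs using Set.Finite.induction_on with
  | empty => exact ⟨⊥, bot_mem_substructure S, fun w => by simp⟩
  | @insert j s _ _ ih =>
    obtain ⟨b, hb, hb'⟩ := ih fun i hi => hr i (Or.inr hi)
    exact ⟨r j ⊔ b, sup_mem_substructure (hr j (Or.inl rfl)) hb, fun w => by simp [hb']⟩

theorem exists_mem_iff_forall {ι : Type*} {s : Set ι} (hs : s.Finite) (r : ι → Fco n)
    (hr : ∀ i ∈ s, r i ∈ S) : ∃ b ∈ S, ∀ w, w ∈ b ↔ ∀ i ∈ s, w ∈ r i := by
  induction s, hs using Set.Finite.induction_on with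
  | empty => exact ⟨⊤, top_mem_substructure S, fun w => by simp⟩
  | @insert j s _ _ ih =>
    obtain ⟨b, hb, hb'⟩ := ih fun i hi => hr i (Or.inr hi)
    exact ⟨r j ⊓ b, inf_mem_substructure (hr j (Or.inl rfl)) hb, fun w => by simp [hb']⟩

end Substructure

theorem _root_.LowerSet.mem_himp_iff {α : Type*} [Preorder α] {a b : LowerSet α} {w : α} :
    w ∈ a ⇨ b ↔ ∀ v ≤ w, v ∈ a → v ∈ b := by
  rw [← LowerSet.Iic_le, le_himp_iff]
  exact ⟨fun h v hvw hv => h ⟨hvw, hv⟩, fun h v hv => h v hv.1 hv.2⟩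

/-! ### The generated subalgebra contains all finite lower sets -/

/-- If every `r ∈ S` containing `w` contains `u`, then some point `w' ≤ w` lies in exactly the same
elements of `S` as `u`. -/
theorem exists_le_equivalent {S : LHA.Substructure (Fco n)} {u w : K n}
    (h : ∀ r ∈ S, w ∈ r → u ∈ r) : ∃ w' ≤ w, ∀ r ∈ S, w' ∈ r ↔ u ∈ r := by
  by_contra! hc
  have hc' : ∀ w' : K n, ∃ r ∈ S, w' ≤ w → (w' ∈ r ∧ u ∉ r ∨ w' ∉ r ∧ u ∈ r) := by
    intro w'
    by_cases hw : w' ≤ w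
    · obtain ⟨r, hr, h⟩ := hc w' hw
      exact ⟨r, hr, fun _ => h⟩
    · exact ⟨⊥, bot_mem_substructure S, fun h => (hw h).elim⟩
  choose r hrS hr using hc'
  obtain ⟨p, hpS, hp⟩ := exists_mem_iff_forall (S := S) (s := {w' | w' ≤ w ∧ u ∈ r w'})
    (w.finite_Iic.subset fun _ h => h.1) r fun _ _ => hrS _
  obtain ⟨q, hqS, hq⟩ := exists_mem_iff_exists (S := S) (s := {w' | w' ≤ w ∧ u ∉ r w'})
    (w.finite_Iic.subset fun _ h => h.1) r fun _ _ => hrS _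
  -- `p` holds and `q` fails at `u`, while no point `≤ w` satisfies `p` without `q`
  have hw : w ∈ p ⇨ q := by
    rw [LowerSet.mem_himp_iff]
    intro v hv hvp
    rcases hr v hv with ⟨h1, h2⟩ | ⟨h1, h2⟩
    · exact (hq v).2 ⟨v, ⟨hv, h2⟩, h1⟩
    · exact (h1 ((hp v).1 hvp v ⟨hv, h2⟩)).elim
  have hu := LowerSet.mem_himp_iff.1 (h _ (himp_mem_substructure hpS hqS) hw) u le_rfl
    ((hp u).2 fun v hv => hv.2)
  obtain ⟨v, hv, huv⟩ := (hq u).1 hu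
  exact hv.2 huv

theorem K.card_symBelow_lt {v w : K n} (h : v < w) :
    (symBelow n v.code).card < (symBelow n w.code).card := by
  refine Finset.card_lt_card ⟨fun c hc => below_trans w hc (K.lt_iff.1 h), fun hsub => ?_⟩
  exact lt_irrefl v (K.lt_iff.2 (hsub (K.lt_iff.1 h)))

/-- Points lying in the same elements of a subalgebra that contains the generators are equal: the
model has no nontrivial bisimulation. -/
theorem K.eq_of_equivalent {S : LHA.Substructure (Fco n)} (hS : ∀ i : Fin n, gen i ∈ S) {u w : K n}
    (h : ∀ r ∈ S, u ∈ r ↔ w ∈ r) : u = w := by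
  induction hm : (symBelow n u.code).card + (symBelow n w.code).card using Nat.strong_induction_on
    generalizing u w with
  | _ m ih =>
    subst hm
    have hval : u.val = w.val := Finset.ext fun i => h _ (hS i)
    have huw : ∀ v < u, v ≤ w := by
      intro v hv
      obtain ⟨w', hw', heq⟩ := exists_le_equivalent (S := S) (u := v) (w := w)
        fun r hr hwr => r.lower hv.le ((h r hr).2 hwr)
      have hle : (symBelow n w'.code).card ≤ (symBelow n w.code).card := by
        rcases hw'.lt_or_eq with h | rfl
        · exact (K.card_symBelow_lt h).le
        · exact le_rfl
      rw [ih _ (by have := K.card_symBelow_lt hv; omega) (fun r hr => (heq r hr).symm) rfl]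
      exact hw'
    have hwu : ∀ v < w, v ≤ u := by
      intro v hv
      obtain ⟨u', hu', heq⟩ := exists_le_equivalent (S := S) (u := v) (w := u)
        fun r hr hwr => r.lower hv.le ((h r hr).1 hwr)
      have hle : (symBelow n u'.code).card ≤ (symBelow n u.code).card := by
        rcases hu'.lt_or_eq with h | rfl
        · exact (K.card_symBelow_lt h).le
        · exact le_rfl
      rw [← ih _ (by have := K.card_symBelow_lt hv; omega) heq rfl]
      exact hu'
    have hnwu : ¬ w < u := fun hlt => K.val_ne_of_Iio_eq_Iic (v := w) (w := u)
      (SetLike.ext fun v => ⟨fun hv => huw v hv, fun hv => lt_of_le_of_lt hv hlt⟩) hval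
    have hnuw : ¬ u < w := fun hlt => K.val_ne_of_Iio_eq_Iic (v := u) (w := w)
      (SetLike.ext fun v => ⟨fun hv => hwu v hv, fun hv => lt_of_le_of_lt hv hlt⟩) hval.symm
    refine K.eq_of_val_of_Iio hval (SetLike.ext fun v => ⟨fun hv => ?_, fun hv => ?_⟩)
    · exact lt_of_le_of_ne (huw v hv) fun h => hnwu (h ▸ hv)
    · exact lt_of_le_of_ne (hwu v hv) fun h => hnuw (h ▸ hv)

theorem K.exists_separating {S : LHA.Substructure (Fco n)} (hS : ∀ i : Fin n, gen i ∈ S) {u w : K n}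
    (h : ¬ u ≤ w) : ∃ r ∈ S, w ∈ r ∧ u ∉ r := by
  by_contra! hc
  obtain ⟨w', hw', heq⟩ := exists_le_equivalent hc
  exact h (K.eq_of_equivalent hS heq ▸ hw')

theorem isFull_of_gen_mem {S : LHA.Substructure (Fco n)} (hS : ∀ i : Fin n, gen i ∈ S) :
    IsFull (S : Set (Fco n)) := by
  intro a ha
  obtain ⟨d, hd⟩ := exists_stage_of_finite ha
  have hsep : ∀ w u : K n, ∃ r ∈ S, ¬ u ≤ w → w ∈ r ∧ u ∉ r := by
    intro w u
    by_cases h : u ≤ w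
    · exact ⟨⊥, bot_mem_substructure S, fun h' => (h' h).elim⟩
    · obtain ⟨r, hr, h⟩ := K.exists_separating hS h
      exact ⟨r, hr, fun _ => h⟩
  choose r hrS hr using hsep
  -- for each `w ∈ a`, an element of `S` containing `w` and avoiding the points outside `a` of
  -- rank at most `d`
  have hsep' : ∀ w : K n, ∃ b ∈ S, ∀ v, v ∈ b ↔
      ∀ u ∈ {u : K n | u.code ∈ stage n (d + 1) ∧ u ∉ a}, v ∈ r w u := fun w =>
    exists_mem_iff_forall ((K.finite_stage n (d + 1)).subset fun _ h => h.1) (r w) fun _ _ => hrS _ _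
  choose p hpS hp using hsep'
  obtain ⟨q, hqS, hq⟩ := exists_mem_iff_exists (S := S) ha p fun _ _ => hpS _
  rwa [eq_of_agree_on_stage hd (b := q) fun w hw => ⟨fun hwa => ?_, fun hwq => ?_⟩]
  · exact (hq w).2 ⟨w, hwa, (hp w w).2 fun u hu => (hr w u fun h => hu.2 (a.lower h hwa)).1⟩
  · by_contra hwa
    obtain ⟨v, hva, hwv⟩ := (hq w).1 hwq
    exact (hr v w fun h => hwa (a.lower h hva)).2 ((hp v w).1 hwv w ⟨hw, hwa⟩)

/-! ### The defining formula -/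

section Formula

open FirstOrder.Language

variable {α : Type} {k : ℕ}

/-- The term `⊥`. -/
def botTerm : LHA.Term α := Constants.term (HeytingFunc.bot : LHA.Constants)

/-- The term `s ⊔ t`. -/
def supTerm (s t : LHA.Term α) : LHA.Term α :=
  Functions.apply₂ (HeytingFunc.sup : LHA.Functions 2) s t

/-- The formula `s ≤ t`, written as `s ⊓ t = s`. -/
def leFormula (s t : LHA.Term (α ⊕ Fin k)) : LHA.BoundedFormula α k :=
  (Functions.apply₂ (HeytingFunc.inf : LHA.Functions 2) s t).bdEqual s

/-- A term, regarded as a term with one more bound variable. -/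
def liftTerm (t : LHA.Term (α ⊕ Fin k)) : LHA.Term (α ⊕ Fin (k + 1)) :=
  t.relabel (Sum.map id Fin.castSucc)

/-- The formula expressing that `b` is the greatest element strictly below `u`. -/
def predFormula (b u : LHA.Term (α ⊕ Fin k)) : LHA.BoundedFormula α k :=
  leFormula b u ⊓ (∼(b.bdEqual u) ⊓
    ∀' (leFormula (&(Fin.last k)) (liftTerm u) ⟹
      (∼((&(Fin.last k)).bdEqual (liftTerm u)) ⟹ leFormula (&(Fin.last k)) (liftTerm b))))

/-- The formula expressing `IsGenIn` of its free variable. The bound variable `&0` stands for `v`.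
In the second conjunct `&1`, `&2` stand for `u`, `u'`; in the third `&1` stands for `w` and the
higher ones for the variables quantified after `w`. -/
def genFormula : LHA.BoundedFormula (Fin 1) 0 :=
  ∃' (predFormula botTerm (&0) ⊓
    ((∃' (predFormula (&0) (&1) ⊓ ∀' (predFormula (&0) (&2) ⟹ (&2).bdEqual (&1)))) ⊓
    ∀' ((∃' predFormula (&2) (&1)) ⟹
      BoundedFormula.iff (leFormula (&1) (Term.var (Sum.inl 0)))
        ((leFormula (&0) (&1) ⊓ ∃' predFormula (&1) (&2)) ⊔
          (∼(leFormula (&0) (&1)) ⊓ ∃' ∃' (∼((&2).bdEqual (&3)) ⊓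
            (predFormula (supTerm (&1) (&0)) (&2) ⊓ predFormula (supTerm (&1) (&0)) (&3))))))))

variable {S : LHA.Substructure (Fco n)}

@[simp] theorem coe_realize_botTerm (v : α → S) :
    ((botTerm.realize v : S) : Fco n) = ⊥ := rfl

@[simp] theorem coe_realize_supTerm (s t : LHA.Term α) (v : α → S) :
    (((supTerm s t).realize v : S) : Fco n) =
      ((s.realize v : S) : Fco n) ⊔ ((t.realize v : S) : Fco n) := rfl

@[simp] theorem realize_liftTerm (t : LHA.Term (α ⊕ Fin k)) (v : α → S) (xs : Fin k → S) (x : S) :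
    (liftTerm t).realize (Sum.elim v (Fin.snoc xs x : Fin (k + 1) → S)) =
      t.realize (Sum.elim v xs) := by
  rw [liftTerm, Term.realize_relabel]
  congr 1
  ext i
  rcases i with i | i <;> simp

@[simp] theorem realize_leFormula (s t : LHA.Term (α ⊕ Fin k)) (v : α → S) (xs : Fin k → S) :
    (leFormula s t).Realize v xs ↔
      ((s.realize (Sum.elim v xs) : S) : Fco n) ≤ ((t.realize (Sum.elim v xs) : S) : Fco n) := by
  rw [leFormula, BoundedFormula.realize_bdEqual, ← Subtype.coe_inj, ← inf_eq_left]
  rfl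

theorem realize_bdEqual_coe (s t : LHA.Term (α ⊕ Fin k)) (v : α → S) (xs : Fin k → S) :
    (s.bdEqual t).Realize v xs ↔
      ((s.realize (Sum.elim v xs) : S) : Fco n) = ((t.realize (Sum.elim v xs) : S) : Fco n) := by
  rw [BoundedFormula.realize_bdEqual, Subtype.coe_inj]

@[simp] theorem realize_predFormula (b u : LHA.Term (α ⊕ Fin k)) (v : α → S) (xs : Fin k → S) :
    (predFormula b u).Realize v xs ↔
      IsPred (S : Set (Fco n)) ((b.realize (Sum.elim v xs) : S) : Fco n)
        ((u.realize (Sum.elim v xs) : S) : Fco n) := by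
  simp only [predFormula, IsPred, BoundedFormula.realize_inf, realize_leFormula,
    BoundedFormula.realize_not, realize_bdEqual_coe, BoundedFormula.realize_all,
    BoundedFormula.realize_imp, Function.comp_apply, Term.realize_var, realize_liftTerm,
    Sum.elim_inr, Fin.snoc_last, Subtype.forall, SetLike.mem_coe, ne_eq]

theorem realize_genFormula (x : Fin 1 → S) :
    Formula.Realize genFormula x ↔ IsGenIn (S : Set (Fco n)) (x 0) := by
  simp [genFormula, IsGenIn, Formula.Realize, Fin.snoc, realize_bdEqual_coe,
    -BoundedFormula.realize_bdEqual, -exists_and_left, -exists_and_right, -Subtype.coe_le_coe]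

end Formula

theorem IsFull.definable {S : LHA.Substructure (Fco n)} (hS : IsFull (S : Set (Fco n))) :
    Set.Definable₁ (∅ : Set S) LHA {x : S | ∃ i : Fin n, (x : Fco n) = gen i} := by
  refine Set.empty_definable_iff.2 ⟨genFormula, Set.ext fun x => ?_⟩
  exact (hS.isGenIn_iff.symm).trans (realize_genFormula x).symm

/-! ### Uniqueness of the free generators -/

/-- The Heyting algebra carried by a subalgebra of `Fco n`. -/
noncomputable abbrev substructureHeyting (S : LHA.Substructure (Fco n)) : HeytingAlgebra S :=
  letI : Max S := ⟨fun a b => ⟨a ⊔ b, sup_mem_substructure a.2 b.2⟩⟩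
  letI : Min S := ⟨fun a b => ⟨a ⊓ b, inf_mem_substructure a.2 b.2⟩⟩
  letI : Top S := ⟨⟨⊤, top_mem_substructure S⟩⟩
  letI : Bot S := ⟨⟨⊥, bot_mem_substructure S⟩⟩
  letI : HImp S := ⟨fun a b => ⟨a ⇨ b, himp_mem_substructure a.2 b.2⟩⟩
  letI : Compl S := ⟨fun a => ⟨(a : Fco n)ᶜ, by
    rw [← himp_bot]; exact himp_mem_substructure a.2 (bot_mem_substructure S)⟩⟩
  Function.Injective.heytingAlgebra (Subtype.val : S → Fco n) Subtype.val_injective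
    Iff.rfl Iff.rfl (fun _ _ => rfl) (fun _ _ => rfl) rfl rfl (fun _ => rfl) (fun _ _ => rfl)

theorem heytingStructure_substructure (S : LHA.Substructure (Fco n)) :
    @heytingStructure S (substructureHeyting S) = Language.Substructure.inducedStructure := by
  ext k f x
  · cases f <;> rfl
  · exact Empty.elim ‹_›

/-- A freely generating family of a subalgebra can be mapped to any family of its elements. -/
theorem FreelyGenerates.exists_hom {ι : Type} {S : LHA.Substructure (Fco n)} {g : ι → S}
    (hg : FreelyGenerates g) (f : ι → S) : ∃ φ : S →[LHA] S, ∀ i, φ (g i) = f i := by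
  have := (@hg S (substructureHeyting S) f).exists
  rwa [heytingStructure_substructure] at this

/-- The points in `stage n d`, which are those of rank less than `d`. -/
abbrev KStage (n d : ℕ) : Type := {w : K n // w.code ∈ stage n d}

theorem K.code_mem_stage_of_le {d : ℕ} {v w : K n} (h : v ≤ w) (hw : w.code ∈ stage n d) :
    v.code ∈ stage n d := by
  rcases h with h | rfl
  · cases d with
    | zero => exact hw.elim
    | succ d => exact stage_mono n d (mem_stage_of_below hw h)
  · exact hw

/-- The restriction of lower sets to `stage n d`, as a homomorphism into a finite Heyting algebra. -/
def restrict (n d : ℕ) : Fco n →[LHA] LowerSet (KStage n d) where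
  toFun a := ⟨{w | w.1 ∈ a}, fun _ _ h hw => a.lower h hw⟩
  map_fun' := by
    intro k f x
    refine SetLike.ext fun w => ?_
    cases f with
    | bot => exact Iff.rfl
    | top => exact Iff.rfl
    | inf => exact Iff.rfl
    | sup => exact Iff.rfl
    | himp =>
      refine LowerSet.mem_himp_iff.trans (Iff.trans ?_ LowerSet.mem_himp_iff.symm)
      exact ⟨fun h v hv => h v.1 hv, fun h v hv => h ⟨v, K.code_mem_stage_of_le hv w.2⟩ hv⟩
  map_rel' := fun r => Empty.elim r

theorem exists_restrict_ne {a b : Fco n} (h : a ≠ b) : ∃ d, restrict n d a ≠ restrict n d b := by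
  by_contra! hc
  refine h (SetLike.ext fun w => ?_)
  obtain ⟨d, hd⟩ := w.mem
  exact SetLike.ext_iff.1 (hc (d + 1)) ⟨w, hd⟩

theorem gen_mem_Fr (i : Fin n) : gen i ∈ Fr n :=
  Language.Substructure.subset_closure ⟨i, rfl⟩

theorem Fr.closure_gen :
    Language.Substructure.closure LHA
      (Set.range fun i : Fin n => (⟨gen i, gen_mem_Fr i⟩ : Fr n)) = ⊤ := by
  rw [eq_top_iff]
  rintro ⟨a, ha⟩ -
  have hle : Fr n ≤ (Language.Substructure.closure LHA
      (Set.range fun i : Fin n => (⟨gen i, gen_mem_Fr i⟩ : Fr n))).map (Fr n).subtype.toHom := by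
    refine Language.Substructure.closure_le.2 ?_
    rintro _ ⟨i, rfl⟩
    exact ⟨⟨gen i, gen_mem_Fr i⟩, Language.Substructure.subset_closure ⟨i, rfl⟩, rfl⟩
  obtain ⟨b, hb, hba⟩ := hle ha
  rwa [show (⟨a, ha⟩ : Fr n) = b from Subtype.ext hba.symm]

/-- A homomorphism on `Fr n` is determined by its values on finitely many elements. -/
theorem finite_hom_Fr (A : Type) [LHA.Structure A] [Finite A] : Finite (Fr n →[LHA] A) := by
  refine Finite.of_injective
    (fun (φ : Fr n →[LHA] A) (i : Fin n) => φ ⟨gen i, gen_mem_Fr i⟩) fun φ ψ h => ?_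
  refine Language.Hom.eq_of_eqOn_dense Fr.closure_gen ?_
  rintro _ ⟨i, rfl⟩
  exact congrFun h i

/-- `Fr n` is Hopfian, being finitely generated and residually finite. -/
theorem Fr.injective_of_surjective {φ : Fr n →[LHA] Fr n} (hφ : Function.Surjective φ) :
    Function.Injective φ := by
  intro a b hab
  by_contra hne
  obtain ⟨d, hd⟩ := exists_restrict_ne fun h => hne (Subtype.ext h)
  have : Finite (KStage n d) := K.finite_stage n d
  have : Finite (LowerSet (KStage n d)) := Finite.of_injective _ SetLike.coe_injective
  have := finite_hom_Fr (n := n) (LowerSet (KStage n d))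
  have hinj : Function.Injective
      fun χ : Fr n →[LHA] LowerSet (KStage n d) => χ.comp φ := by
    intro χ ψ h
    refine DFunLike.ext _ _ fun c => ?_
    obtain ⟨c, rfl⟩ := hφ c
    exact DFunLike.congr_fun h c
  -- so the restriction to `stage n d` factors through `φ`
  obtain ⟨χ, hχ⟩ := Finite.surjective_of_injective hinj ((restrict n d).comp (Fr n).subtype.toHom)
  refine hd ?_
  have key : ∀ c : Fr n, restrict n d c = χ (φ c) := fun c => (DFunLike.congr_fun hχ c).symm
  rw [key, key, hab]

theorem Fr.surjective_of_gen_mem_range {φ : Fr n →[LHA] Fr n}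
    (h : ∀ i : Fin n, ∃ a, φ a = ⟨gen i, gen_mem_Fr i⟩) : Function.Surjective φ := by
  rw [← Language.Hom.range_eq_top, eq_top_iff, ← Fr.closure_gen,
    Language.Substructure.closure_le]
  rintro _ ⟨i, rfl⟩
  exact h i

/-- Every freely generating family of `Fr n` enumerates the set of the elements `gen i`: there is an
automorphism taking the one to the other, and the set of the `gen i` is invariant, being definable
without parameters. -/
theorem FreelyGenerates.exists_eq_iff {g : Fin n → Fr n} (hg : FreelyGenerates g) (x : Fco n) :
    (∃ i, x = g i) ↔ ∃ i, x = gen i := by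
  obtain ⟨φ, hφ⟩ := hg.exists_hom fun i => ⟨gen i, gen_mem_Fr i⟩
  have hsurj := Fr.surjective_of_gen_mem_range fun i => ⟨g i, hφ i⟩
  have hinj := Fr.injective_of_surjective hsurj
  let e : Fr n ≃[LHA] Fr n :=
    { toEquiv := Equiv.ofBijective φ ⟨hinj, hsurj⟩
      map_fun' := φ.map_fun'
      map_rel' := fun r => Empty.elim r }
  have hfull := isFull_of_gen_mem (S := Fr n) gen_mem_Fr
  have hinv : ∀ y : Fr n, (∃ i, (φ y : Fco n) = gen i) ↔ ∃ i, (y : Fco n) = gen i := by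
    intro y
    have h := Language.StrongHomClass.realize_formula e (genFormula : LHA.Formula (Fin 1))
      (v := fun _ => y)
    rw [realize_genFormula, realize_genFormula, hfull.isGenIn_iff, hfull.isGenIn_iff] at h
    exact h
  constructor
  · rintro ⟨i, rfl⟩
    exact (hinv (g i)).1 ⟨i, congrArg Subtype.val (hφ i)⟩
  · rintro ⟨i, rfl⟩
    obtain ⟨j, hj⟩ := (hinv ⟨gen i, gen_mem_Fr i⟩).2 ⟨i, rfl⟩
    exact ⟨j, congrArg Subtype.val <| hinj <| Subtype.ext <|
      hj.trans (congrArg Subtype.val (hφ j).symm)⟩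

end Bellissima

theorem mainTheorem4 (n : ℕ) (hn : 0 < n)
    (H : Bellissima.LHA.Substructure (Bellissima.Fco n))
    (hH : Dense (H : Set (Bellissima.Fco n))) :
    ((∀ i : Fin n, Bellissima.gen i ∈ H) →
      Set.Definable₁ (∅ : Set H) Bellissima.LHA
        {x : H | ∃ i : Fin n, (x : Bellissima.Fco n) = Bellissima.gen i}) ∧
    (∀ g : Fin n → Bellissima.Fr n, Bellissima.FreelyGenerates g →
      (∀ i : Fin n, (g i : Bellissima.Fco n) ∈ H) →
      Set.Definable₁ (∅ : Set H) Bellissima.LHA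
        {x : H | ∃ i : Fin n, (x : Bellissima.Fco n) = (g i : Bellissima.Fco n)}) := by
  have hfull : Bellissima.IsFull (H : Set (Bellissima.Fco n)) := fun _ ha =>
    Bellissima.mem_of_dense_of_finite hH ha
  refine ⟨fun _ => hfull.definable, fun g hg _ => ?_⟩
  simp only [hg.exists_eq_iff]
  exact hfull.definable
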